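/- Let $M$ be an $n$-dimensional smooth manifold, $n\ge 2$, let $\alpha(y)=\sqrt{a_{ij}(x)y^iy^j}$ be given by a smooth Riemannian metric $a$ and $\beta(y)=b_i(x)y^i$ by a smooth 1-form on $M$, and let $c_1,c_2,c_3\in\mathbb R$ be such that the generalized Randers metric $$F=\sqrt{c_1\alpha^2+2c_2\alpha\beta+c_3\beta^2}$$ is a Finsler metric on $M$ (smooth on $TM\setminus 0$, nonnegative, positively 1-homogeneous on the fibres, with positive definite $\mathbf g_y(u,v)=\frac12\frac{\partial^2}{\partial s\partial t}F^2(y+su+tv)|_{s=t=0}$ for $y\ne0$). Let $\mathbf C_y(u,v,w)=\frac12\frac{d}{dt}\mathbf g_{y+tw}(u,v)|_{t=0}$ be the Cartan torsion, $I_i=g^{jk}C_{ijk}$ the mean Cartan torsion, and let $$\|\mathbf C\|=\sqrt{g^{il}g^{jm}g^{kr}C_{ijk}C_{lmr}},\qquad \|\mathbf I\|=\sqrt{g^{ij}I_iI_j}$$ be their norms at $y$ with respect to $\mathbf g_y$, where components refer to an arbitrary basis of $T_xM$. Put $b^2=a^{ij}b_ib_j$, $s=\beta/\alpha$, $\phi(s)=\sqrt{c_1+2c_2s+c_3s^2}$,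 so that $F=\alpha\,\phi(s)$. Then at every $x\in M$ and every $y\in T_xM\setminus\{0\}$: (i) $\phi(s)^2=c_1+2c_2s+c_3s^2>0$, $c_1+c_2s>0$ and $(c_1+c_2s)\phi^2+(b^2-s^2)(c_1c_3-c_2^2)>0$. The functions $$\mathsf a=\phi(\phi-s\phi'),\qquad A=(n-2)\frac{s\phi''}{\phi-s\phi'}-(n+1)\frac{\phi'}{\phi}-\frac{(b^2-s^2)\phi'''-3s\phi''}{(b^2-s^2)\phi''+\phi-s\phi'}$$ are given by $\mathsf a=c_1+c_2s$ and $$A=\frac{(n-2)s(c_1c_3-c_2^2)}{(c_1+c_2s)\phi^2}-\frac{(n+1)(c_2+c_3s)}{\phi^2}+\frac{3(c_1c_3-c_2^2)s\phi^2+3(b^2-s^2)(c_1c_3-c_2^2)(c_2+c_3s)}{\phi^2\big[(c_1+c_2s)\phi^2+(b^2-s^2)(c_1c_3-c_2^2)\big]}.$$ (ii) $A\neq0$ whenever $c_2\ne0$, and $$p:=\frac{n+1}{\mathsf aA}\big[s(\phi\phi''+\phi'\phi')-\phi\phi'\big]=-\frac{(n+1)c_2}{(c_1+c_2s)A}$$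 (if $c_2=0$, we set $p:=0$). (iii) With $q:=1-p$, $$\|\mathbf C\|=\sqrt{\frac{3p^2+6pq+(n+1)q^2}{n+1}}\;\|\mathbf I\| .$$ -/

import Mathlib

open scoped Manifold ContDiff Bundle

noncomputable section

namespace FinslerGeometry

/-! ### Pointwise tensors of a function `F` on a single tangent space -/

section Pointwise

variable {V : Type*} [AddCommGroup V] [Module ℝ V]

/-- The fundamental tensor `g_y(u,v) = 1/2 ∂²/∂s∂t F²(y + s u + t v)` at `s = t = 0`. -/
def fundamentalTensor (F : V → ℝ) (y u v : V) : ℝ :=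
  1 / 2 * deriv (fun s : ℝ => deriv (fun t : ℝ => F (y + s • u + t • v) ^ 2) 0) 0

/-- The Cartan torsion `C_y(u,v,w) = 1/2 d/dt g_{y + t w}(u,v)` at `t = 0`. -/
def cartanTorsion (F : V → ℝ) (y u v w : V) : ℝ :=
  1 / 2 * deriv (fun t : ℝ => fundamentalTensor F (y + t • w) u v) 0

variable {ι : Type*} [Fintype ι] [DecidableEq ι]

/-- The matrix `g_{ij}(y)` of the fundamental tensor in the basis `e`. -/
def gramMatrix (F : V → ℝ) (e : Module.Basis ι ℝ V) (y : V) : Matrix ι ι ℝ :=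
  Matrix.of fun i j => fundamentalTensor F y (e i) (e j)

/-- The mean Cartan torsion `I_y(u) = g^{jk}(y) C_y(u, e_j, e_k)`. -/
def meanCartanTorsion (F : V → ℝ) (e : Module.Basis ι ℝ V) (y u : V) : ℝ :=
  ∑ j, ∑ k, (gramMatrix F e y)⁻¹ j k * cartanTorsion F y u (e j) (e k)

/-- The norm of the tensor `C_y` with respect to the inner product `g_y`:
`‖C‖² = g^{il} g^{jm} g^{kr} C_{ijk} C_{lmr}`. -/
def cartanNorm (F : V → ℝ) (e : Module.Basis ι ℝ V) (y : V) : ℝ :=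
  Real.sqrt (∑ i, ∑ j, ∑ k, ∑ l, ∑ m, ∑ r,
    (gramMatrix F e y)⁻¹ i l * (gramMatrix F e y)⁻¹ j m * (gramMatrix F e y)⁻¹ k r *
      cartanTorsion F y (e i) (e j) (e k) * cartanTorsion F y (e l) (e m) (e r))

/-- The norm of the covector `I_y` with respect to the inner product `g_y`:
`‖I‖² = g^{ij} I_i I_j`. -/
def meanCartanNorm (F : V → ℝ) (e : Module.Basis ι ℝ V) (y : V) : ℝ :=
  Real.sqrt (∑ i, ∑ j, (gramMatrix F e y)⁻¹ i j *
    meanCartanTorsion F e y (e i) * meanCartanTorsion F e y (e j))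

/-- `b² = a^{ij} b_i b_j`, where `a_{ij} = a(e_i, e_j)` and `b_i = β(e_i)`. -/
def covectorNormSq (a : V → V → ℝ) (β : V → ℝ) (e : Module.Basis ι ℝ V) : ℝ :=
  ∑ i, ∑ j, (Matrix.of fun k l => a (e k) (e l))⁻¹ i j * β (e i) * β (e j)

end Pointwise

/-! ### Finsler metrics on a manifold -/

section Manifold

variable {n : ℕ} {M : Type*} [TopologicalSpace M] [ChartedSpace (EuclideanSpace ℝ (Fin n)) M]

/-- The restriction `F_x` of a function on the tangent bundle to the tangent space at `x`. -/
def restrictFiber (F : TangentBundle (𝓡 n) M → ℝ) (x : M) (v : TangentSpace (𝓡 n) x) : ℝ :=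
  F ⟨x, v⟩

/-- Finsler metrics: nonnegative functions on `TM`, smooth on the slit tangent bundle, positively
`1`-homogeneous on the fibers, with positive definite fundamental tensor `g_y` for `y ≠ 0`. -/
structure IsFinslerMetric [IsManifold (𝓡 n) ∞ M] (F : TangentBundle (𝓡 n) M → ℝ) : Prop where
  nonneg : ∀ v, 0 ≤ F v
  smooth : ContMDiffOn (𝓡 n).tangent 𝓘(ℝ, ℝ) ∞ F {v | v.2 ≠ 0}
  homogeneous : ∀ (x : M) (v : TangentSpace (𝓡 n) x) (r : ℝ), 0 < r →
    restrictFiber F x (r • v) = r * restrictFiber F x v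
  posDef : ∀ (x : M) (y : TangentSpace (𝓡 n) x), y ≠ 0 →
    ∀ u : TangentSpace (𝓡 n) x, u ≠ 0 → 0 < fundamentalTensor (restrictFiber F x) y u u

variable [IsManifold (𝓡 n) ∞ M]

/-- Smooth Riemannian metrics on `M`. -/
abbrev SmoothRiemannianMetric (n : ℕ) (M : Type*) [TopologicalSpace M]
    [ChartedSpace (EuclideanSpace ℝ (Fin n)) M] [IsManifold (𝓡 n) ∞ M] :=
  Bundle.ContMDiffRiemannianMetric (𝓡 n) ∞ (EuclideanSpace ℝ (Fin n))
    (fun x : M => TangentSpace (𝓡 n) x)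

/-- Smooth `1`-forms on `M`: smooth sections of the cotangent bundle. -/
abbrev SmoothOneForm (n : ℕ) (M : Type*) [TopologicalSpace M]
    [ChartedSpace (EuclideanSpace ℝ (Fin n)) M] [IsManifold (𝓡 n) ∞ M] :=
  ContMDiffSection (𝓡 n) (EuclideanSpace ℝ (Fin n) →L[ℝ] ℝ) ∞
    (fun x : M => TangentSpace (𝓡 n) x →L[ℝ] ℝ)

/-- `α(y) = √(a(y,y))`. -/
def alphaNorm (a : SmoothRiemannianMetric n M) (x : M) (y : TangentSpace (𝓡 n) x) : ℝ :=
  Real.sqrt (a.inner x y y)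

/-- `F = √(c₁ α² + 2 c₂ α β + c₃ β²)`. -/
def generalizedRanders (c₁ c₂ c₃ : ℝ) (a : SmoothRiemannianMetric n M)
    (β : SmoothOneForm n M) (v : TangentBundle (𝓡 n) M) : ℝ :=
  Real.sqrt (c₁ * alphaNorm a v.1 v.2 ^ 2 + 2 * c₂ * alphaNorm a v.1 v.2 * β v.1 v.2
    + c₃ * β v.1 v.2 ^ 2)

end Manifold

/-! ### The scalar functions attached to an `(α, β)`-metric `F = α φ(β / α)`

Here `B` stands for `b² = ‖β‖_α²` and `s = β / α`. -/

/-- `a = φ (φ - s φ')`. -/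
def abFunA (φ : ℝ → ℝ) (s : ℝ) : ℝ := φ s * (φ s - s * deriv φ s)

/-- `A = (n-2) s φ'' / (φ - s φ') - (n+1) φ' / φ
  - ((b² - s²) φ''' - 3 s φ'') / ((b² - s²) φ'' + φ - s φ')`. -/
def abBigA (n : ℕ) (φ : ℝ → ℝ) (B s : ℝ) : ℝ :=
  ((n : ℝ) - 2) * (s * iteratedDeriv 2 φ s / (φ s - s * deriv φ s))
    - ((n : ℝ) + 1) * (deriv φ s / φ s)
    - ((B - s ^ 2) * iteratedDeriv 3 φ s - 3 * s * iteratedDeriv 2 φ s)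
      / ((B - s ^ 2) * iteratedDeriv 2 φ s + φ s - s * deriv φ s)

/-- `p = (n+1) / (a A) * (s (φ φ'' + φ' φ') - φ φ')`. -/
def abP (n : ℕ) (φ : ℝ → ℝ) (B s : ℝ) : ℝ :=
  ((n : ℝ) + 1) / (abFunA φ s * abBigA n φ B s)
    * (s * (φ s * iteratedDeriv 2 φ s + deriv φ s * deriv φ s) - φ s * deriv φ s)

/-- `φ(s) = √(c₁ + 2 c₂ s + c₃ s²)`. -/
def randersPhi (c₁ c₂ c₃ s : ℝ) : ℝ := Real.sqrt (c₁ + 2 * c₂ * s + c₃ * s ^ 2)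

/-- The closed form of `A` for `φ = randersPhi c₁ c₂ c₃`, with `D = c₁ c₃ - c₂²`. -/
def randersBigA (n : ℕ) (c₁ c₂ c₃ B s : ℝ) : ℝ :=
  let D := c₁ * c₃ - c₂ ^ 2
  let ψ := c₁ + 2 * c₂ * s + c₃ * s ^ 2
  ((n : ℝ) - 2) * s * D / ((c₁ + c₂ * s) * ψ)
    - ((n : ℝ) + 1) * (c₂ + c₃ * s) / ψ
    + (3 * D * s * ψ + 3 * (B - s ^ 2) * D * (c₂ + c₃ * s))
      / (ψ * ((c₁ + c₂ * s) * ψ + (B - s ^ 2) * D))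

/-- `p = -(n+1) c₂ / ((c₁ + c₂ s) A)`. -/
def randersP (n : ℕ) (c₁ c₂ c₃ B s : ℝ) : ℝ :=
  -(((n : ℝ) + 1) * c₂) / ((c₁ + c₂ * s) * randersBigA n c₁ c₂ c₃ B s)

end FinslerGeometry

end

open FinslerGeometry

/-! Put `l = a(y,·)/α`, `m = β - s l`, `h = a - l ⊗ l`, `T = c₁ + c₂ s`, `ψ = φ²`, `k = c₂ + c₃ s`,
`μ = b² - s²`, `w = Tψ + μ(c₁c₃ - c₂²)`. Differentiating `F²` gives `g = T h + ψ l² + k (l m + m l)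
+ c₃ m²` (`fundamentalTensor_randers_eq`) and `C = c₂/(2α) Sym(h ⊗ m)` (`cartanTorsion_randers`).

The operator `h G⁻¹` has eigenvalue `1/T` with multiplicity `n - 2`, `0` once, and `ρ = ψ/w` on `m`.
With `κ = c₂/(2α)`, contracting gives `I = κ ((n-2)/T + 3ρ) m` and `‖C‖² = 3κ² ((n-2)/T² + 3ρ²)
‖m‖²`. Since `A = -c₂ ((n-2)/T + 3ρ)` (`randersBigA_eq`), `p = (n+1)/(n-2+3ρT)` when `c₂ ≠ 0`, and
the ratio of the two norms is a rational identity in `n` and `ρT`.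

Positivity of `ψ`, `T`, `w` comes from testing `g` on suitable vectors. -/

namespace FinslerGeometry

/-! ### Derivatives of the radicand along lines: fundamental tensor and Cartan torsion. -/

section Calculus

variable {V : Type*} [AddCommGroup V] [Module ℝ V]

/-- The radicand `c₁ α² + 2 c₂ α β + c₃ β²` of a generalized Randers metric on a vector space. -/
noncomputable def randersSq (c₁ c₂ c₃ : ℝ) (a : LinearMap.BilinForm ℝ V) (β : V →ₗ[ℝ] ℝ)
    (z : V) : ℝ :=
  c₁ * a z z + 2 * c₂ * √(a z z) * β z + c₃ * β z ^ 2

theorem hasDerivAt_linear_line (f : V →ₗ[ℝ] ℝ) (y w : V) :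
    HasDerivAt (fun t : ℝ => f (y + t • w)) (f w) 0 := by
  simp only [map_add, map_smul, smul_eq_mul]
  simpa using ((hasDerivAt_id (0 : ℝ)).mul_const (f w)).const_add (f y)

variable {a : LinearMap.BilinForm ℝ V} {β : V →ₗ[ℝ] ℝ} {c₁ c₂ c₃ : ℝ} {F : V → ℝ}

theorem hasDerivAt_quadratic_line (hsymm : ∀ u v, a u v = a v u) (y w : V) :
    HasDerivAt (fun t : ℝ => a (y + t • w) (y + t • w)) (2 * a y w) 0 := by
  have h : (fun t : ℝ => a (y + t • w) (y + t • w))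
      = fun t : ℝ => a y y + t * (2 * a y w) + t * t * a w w := by
    funext t
    simp only [map_add, map_smul, smul_eq_mul, LinearMap.add_apply, LinearMap.smul_apply,
      hsymm w y]
    ring
  rw [h]
  have h1 := ((hasDerivAt_id (0 : ℝ)).mul_const (2 * a y w)).const_add (a y y)
  have h2 := ((hasDerivAt_id (0 : ℝ)).mul (hasDerivAt_id (0 : ℝ))).mul_const (a w w)
  refine (h1.add h2).congr_deriv ?_
  simp

theorem hasDerivAt_sqrt_line (hsymm : ∀ u v, a u v = a v u) {y : V} (hy : 0 < a y y) (w : V) :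
    HasDerivAt (fun t : ℝ => √(a (y + t • w) (y + t • w))) (a y w / √(a y y)) 0 := by
  have h := (hasDerivAt_quadratic_line hsymm y w).sqrt (by simpa using hy.ne')
  simpa only [zero_smul, add_zero, mul_div_mul_left _ _ (two_ne_zero' ℝ)] using h

theorem hasDerivAt_randersSq_line (hsymm : ∀ u v, a u v = a v u) {y : V} (hy : 0 < a y y)
    (v : V) :
    HasDerivAt (fun t : ℝ => randersSq c₁ c₂ c₃ a β (y + t • v))
      (2 * (c₁ * a y v + c₂ * (a y v / √(a y y) * β y + √(a y y) * β v) + c₃ * β y * β v)) 0 := by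
  have h1 := (hasDerivAt_quadratic_line hsymm y v).const_mul c₁
  have h2 := (hasDerivAt_sqrt_line hsymm hy v).const_mul (2 * c₂)
  have h3 := hasDerivAt_linear_line β y v
  have h := (h1.add (h2.mul h3)).add ((h3.pow 2).const_mul c₃)
  refine h.congr_deriv ?_
  simp
  ring

/-- A line through `y ≠ 0` meets the origin, where `α` is not differentiable, at most once and not
at `t = 0`. Hence first-derivative formulas hold near `t = 0` and can be differentiated again. -/
theorem eventually_line_ne_zero {y : V} (hy : y ≠ 0) (u : V) :
    ∀ᶠ t : ℝ in nhds 0, y + t • u ≠ 0 := by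
  by_cases hu : ∃ t : ℝ, y + t • u = 0
  · obtain ⟨t₀, ht₀⟩ := hu
    have h0 : (0 : ℝ) ≠ t₀ := by
      rintro rfl
      simp at ht₀
      exact hy ht₀
    filter_upwards [isOpen_ne.mem_nhds h0] with t ht h
    have h2 : (t - t₀) • u = 0 := by
      have : (t - t₀) • u = (y + t • u) - (y + t₀ • u) := by
        rw [sub_smul]; abel
      rw [this, h, ht₀, sub_zero]
    rcases smul_eq_zero.1 h2 with h3 | h3
    · exact ht (sub_eq_zero.1 h3)
    · simp [h3] at h
      exact hy h
  · push Not at hu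
    exact Filter.Eventually.of_forall hu

theorem fundamentalTensor_randers (hsymm : ∀ u v, a u v = a v u)
    (hpos : ∀ z, z ≠ 0 → 0 < a z z) (hF : ∀ z, F z ^ 2 = randersSq c₁ c₂ c₃ a β z)
    {y : V} (hy : y ≠ 0) (u v : V) :
    fundamentalTensor F y u v = c₁ * a u v
      + c₂ * (β y * a u v / √(a y y) + (a y u * β v + a y v * β u) / √(a y y)
        - β y * a y u * a y v / √(a y y) ^ 3) + c₃ * β u * β v := by
  have hE : (fun s : ℝ => deriv (fun t : ℝ => F (y + s • u + t • v) ^ 2) 0) =ᶠ[nhds 0]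
      fun s : ℝ => 2 * (c₁ * a (y + s • u) v + c₂ * (a (y + s • u) v
        / √(a (y + s • u) (y + s • u)) * β (y + s • u)
        + √(a (y + s • u) (y + s • u)) * β v) + c₃ * β (y + s • u) * β v) := by
    filter_upwards [eventually_line_ne_zero hy u] with s hs
    simp only [hF]
    exact (hasDerivAt_randersSq_line hsymm (hpos _ hs) v).deriv
  have hr : 0 < √(a y y) := Real.sqrt_pos.2 (hpos y hy)
  have h1 : HasDerivAt (fun s : ℝ => a (y + s • u) v) (a u v) 0 :=
    hasDerivAt_linear_line (a.flip v) y u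
  have h2 := hasDerivAt_linear_line β y u
  have h3 := hasDerivAt_sqrt_line hsymm (hpos y hy) u
  have h := (((h1.const_mul c₁).add ((((h1.div h3 (by simpa using hr.ne')).mul h2).add
    (h3.mul_const (β v))).const_mul c₂)).add ((h2.const_mul c₃).mul_const (β v))).const_mul 2
  rw [fundamentalTensor, hE.deriv_eq.trans h.deriv]
  simp only [zero_smul, add_zero, Pi.div_apply]
  field_simp
  ring

theorem cartanTorsion_randers (hsymm : ∀ u v, a u v = a v u)
    (hpos : ∀ z, z ≠ 0 → 0 < a z z) (hF : ∀ z, F z ^ 2 = randersSq c₁ c₂ c₃ a β z)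
    {y : V} (hy : y ≠ 0) (u v w : V) {h : V → V → ℝ} {l m : V → ℝ}
    (hl : ∀ u, l u = a y u / √(a y y)) (hm : ∀ u, m u = β u - β y / √(a y y) * l u)
    (hh : ∀ u v, h u v = a u v - l u * l v) :
    cartanTorsion F y u v w
      = c₂ / (2 * √(a y y)) * (h u v * m w + h v w * m u + h u w * m v) := by
  have hE : (fun t : ℝ => fundamentalTensor F (y + t • w) u v) =ᶠ[nhds 0]
      fun t : ℝ => c₁ * a u v
      + c₂ * (β (y + t • w) * a u v / √(a (y + t • w) (y + t • w))
        + (a (y + t • w) u * β v + a (y + t • w) v * β u) / √(a (y + t • w) (y + t • w))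
        - β (y + t • w) * a (y + t • w) u * a (y + t • w) v
          / √(a (y + t • w) (y + t • w)) ^ 3) + c₃ * β u * β v := by
    filter_upwards [eventually_line_ne_zero hy w] with t ht
    exact fundamentalTensor_randers hsymm hpos hF ht u v
  have hr : 0 < √(a y y) := Real.sqrt_pos.2 (hpos y hy)
  have h1 : ∀ v, HasDerivAt (fun s : ℝ => a (y + s • w) v) (a w v) 0 := fun v =>
    hasDerivAt_linear_line (a.flip v) y w
  have h2 := hasDerivAt_linear_line β y w
  have h3 := hasDerivAt_sqrt_line hsymm (hpos y hy) w
  have hr' : √(a (y + (0 : ℝ) • w) (y + (0 : ℝ) • w)) ≠ 0 := by simpa using hr.ne'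
  have hd := (((((h2.mul_const (a u v)).div h3 hr').add
    ((((h1 u).mul_const (β v)).add ((h1 v).mul_const (β u))).div h3 hr')).sub
    (((h2.mul (h1 u)).mul (h1 v)).div (h3.pow 3) (pow_ne_zero 3 hr'))).const_mul c₂).const_add
    (c₁ * a u v) |>.add_const (c₃ * β u * β v)
  rw [cartanTorsion, hE.deriv_eq.trans hd.deriv]
  simp only [zero_smul, add_zero, Pi.mul_apply, Pi.pow_apply, Pi.add_apply, hh, hm, hl,
    hsymm w u, hsymm w v]
  field_simp
  ring

end Calculus

/-! ### The one-variable functions attached to `φ`. -/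

section Scalar

variable {c₁ c₂ c₃ s : ℝ}

theorem eventually_randersPhi_radicand_pos (h : 0 < c₁ + 2 * c₂ * s + c₃ * s ^ 2) :
    ∀ᶠ t in nhds s, 0 < c₁ + 2 * c₂ * t + c₃ * t ^ 2 :=
  (show Continuous fun t : ℝ => c₁ + 2 * c₂ * t + c₃ * t ^ 2 by fun_prop).continuousAt.eventually
    (lt_mem_nhds h)

theorem randersPhi_pos (h : 0 < c₁ + 2 * c₂ * s + c₃ * s ^ 2) : 0 < randersPhi c₁ c₂ c₃ s :=
  Real.sqrt_pos.2 h

theorem randersPhi_sq (h : 0 < c₁ + 2 * c₂ * s + c₃ * s ^ 2) :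
    randersPhi c₁ c₂ c₃ s ^ 2 = c₁ + 2 * c₂ * s + c₃ * s ^ 2 :=
  Real.sq_sqrt h.le

theorem hasDerivAt_randersPhi (h : 0 < c₁ + 2 * c₂ * s + c₃ * s ^ 2) :
    HasDerivAt (randersPhi c₁ c₂ c₃) ((c₂ + c₃ * s) / randersPhi c₁ c₂ c₃ s) s := by
  have h1 : HasDerivAt (fun t : ℝ => c₁ + 2 * c₂ * t + c₃ * t ^ 2) (2 * (c₂ + c₃ * s)) s := by
    have := (((hasDerivAt_id s).const_mul (2 * c₂)).const_add c₁).add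
      (((hasDerivAt_id s).pow 2).const_mul c₃)
    refine this.congr_deriv ?_
    simp
    ring
  have h2 := h1.sqrt h.ne'
  rw [mul_div_mul_left _ _ two_ne_zero] at h2
  exact h2

theorem iteratedDeriv_two_randersPhi (h : 0 < c₁ + 2 * c₂ * s + c₃ * s ^ 2) :
    iteratedDeriv 2 (randersPhi c₁ c₂ c₃) s
      = (c₁ * c₃ - c₂ ^ 2) / randersPhi c₁ c₂ c₃ s ^ 3 := by
  have hE : deriv (randersPhi c₁ c₂ c₃) =ᶠ[nhds s]
      fun t => (c₂ + c₃ * t) / randersPhi c₁ c₂ c₃ t := by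
    filter_upwards [eventually_randersPhi_radicand_pos h] with t ht
    exact (hasDerivAt_randersPhi ht).deriv
  have hφ := randersPhi_pos h
  have hd := (((hasDerivAt_id s).const_mul c₃).const_add c₂).div (hasDerivAt_randersPhi h) hφ.ne'
  rw [iteratedDeriv_succ, iteratedDeriv_one, hE.deriv_eq.trans hd.deriv]
  have hsq := randersPhi_sq h
  simp only [id]
  field_simp
  rw [hsq]
  ring

theorem iteratedDeriv_three_randersPhi (h : 0 < c₁ + 2 * c₂ * s + c₃ * s ^ 2) :
    iteratedDeriv 3 (randersPhi c₁ c₂ c₃) s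
      = -3 * (c₁ * c₃ - c₂ ^ 2) * (c₂ + c₃ * s) / randersPhi c₁ c₂ c₃ s ^ 5 := by
  have hE : iteratedDeriv 2 (randersPhi c₁ c₂ c₃) =ᶠ[nhds s]
      fun t => (c₁ * c₃ - c₂ ^ 2) / randersPhi c₁ c₂ c₃ t ^ 3 := by
    filter_upwards [eventually_randersPhi_radicand_pos h] with t ht
    exact iteratedDeriv_two_randersPhi ht
  have hφ := randersPhi_pos h
  have hd := (hasDerivAt_const s (c₁ * c₃ - c₂ ^ 2)).div ((hasDerivAt_randersPhi h).pow 3)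
    (pow_ne_zero 3 hφ.ne')
  rw [iteratedDeriv_succ, hE.deriv_eq.trans hd.deriv]
  simp only [Pi.pow_apply]
  field_simp
  ring

theorem abFunA_randersPhi (h : 0 < c₁ + 2 * c₂ * s + c₃ * s ^ 2) :
    abFunA (randersPhi c₁ c₂ c₃) s = c₁ + c₂ * s := by
  have hφ := randersPhi_pos h
  have hsq := randersPhi_sq h
  rw [abFunA, (hasDerivAt_randersPhi h).deriv]
  field_simp
  rw [hsq]
  ring

variable {B : ℝ} {n : ℕ}

theorem abBigA_randersPhi (h : 0 < c₁ + 2 * c₂ * s + c₃ * s ^ 2)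
    (hw : 0 < (c₁ + c₂ * s) * (c₁ + 2 * c₂ * s + c₃ * s ^ 2) + (B - s ^ 2) * (c₁ * c₃ - c₂ ^ 2)) :
    abBigA n (randersPhi c₁ c₂ c₃) B s = randersBigA n c₁ c₂ c₃ B s := by
  have hφ := randersPhi_pos h
  have hsq := randersPhi_sq h
  have h1 : randersPhi c₁ c₂ c₃ s - s * ((c₂ + c₃ * s) / randersPhi c₁ c₂ c₃ s)
      = (c₁ + c₂ * s) / randersPhi c₁ c₂ c₃ s := by
    field_simp
    rw [hsq]
    ring
  simp only [abBigA, randersBigA]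
  rw [(hasDerivAt_randersPhi h).deriv, iteratedDeriv_two_randersPhi h,
    iteratedDeriv_three_randersPhi h, add_sub_assoc, h1]
  rw [← hsq] at hw ⊢
  set f := randersPhi c₁ c₂ c₃ s
  have h2 : (B - s ^ 2) * ((c₁ * c₃ - c₂ ^ 2) / f ^ 3) + (c₁ + c₂ * s) / f
      = ((c₁ + c₂ * s) * f ^ 2 + (B - s ^ 2) * (c₁ * c₃ - c₂ ^ 2)) / f ^ 3 := by
    field_simp
    ring
  rw [h2]
  set w := (c₁ + c₂ * s) * f ^ 2 + (B - s ^ 2) * (c₁ * c₃ - c₂ ^ 2)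
  field_simp
  ring

/-- With `D = c₁c₃ - c₂²`, the identity `k T - s D = c₂ ψ` factors `c₂` out of the closed form. The
other factor is a sum of a nonnegative and a positive term for `n ≥ 2`, and it is the one appearing
in the mean Cartan torsion. -/
theorem randersBigA_eq (h : 0 < c₁ + 2 * c₂ * s + c₃ * s ^ 2) (hT : 0 < c₁ + c₂ * s)
    (hw : 0 < (c₁ + c₂ * s) * (c₁ + 2 * c₂ * s + c₃ * s ^ 2) + (B - s ^ 2) * (c₁ * c₃ - c₂ ^ 2)) :
    randersBigA n c₁ c₂ c₃ B s = -(c₂ * (((n : ℝ) - 2) / (c₁ + c₂ * s)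
      + 3 * ((c₁ + 2 * c₂ * s + c₃ * s ^ 2) / ((c₁ + c₂ * s) * (c₁ + 2 * c₂ * s + c₃ * s ^ 2)
        + (B - s ^ 2) * (c₁ * c₃ - c₂ ^ 2))))) := by
  have key : ∀ T ψ D k μ w : ℝ, T ≠ 0 → ψ ≠ 0 → w ≠ 0 → w = T * ψ + μ * D →
      k * T - s * D = c₂ * ψ →
      ((n : ℝ) - 2) * s * D / (T * ψ) - ((n : ℝ) + 1) * k / ψ
        + (3 * D * s * ψ + 3 * μ * D * k) / (ψ * w)
        = -(c₂ * (((n : ℝ) - 2) / T + 3 * (ψ / w))) := by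
    intro T ψ D k μ w hT hψ hw hwe hk
    rw [show c₂ = (k * T - s * D) / ψ by rw [hk]; field_simp]
    field_simp
    rw [hwe]
    ring
  exact key _ _ _ _ _ _ hT.ne' h.ne' hw.ne' rfl (by ring)

theorem abP_randersPhi (h : 0 < c₁ + 2 * c₂ * s + c₃ * s ^ 2)
    (hw : 0 < (c₁ + c₂ * s) * (c₁ + 2 * c₂ * s + c₃ * s ^ 2) + (B - s ^ 2) * (c₁ * c₃ - c₂ ^ 2)) :
    abP n (randersPhi c₁ c₂ c₃) B s = randersP n c₁ c₂ c₃ B s := by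
  have hφ := randersPhi_pos h
  have hsq := randersPhi_sq h
  rw [abP, randersP, abFunA_randersPhi h, abBigA_randersPhi h hw,
    (hasDerivAt_randersPhi h).deriv, iteratedDeriv_two_randersPhi h]
  -- This is `s (φ²/2)'' - (φ²/2)'`, where `(φ²/2)' = c₂ + c₃ s` and `(φ²/2)'' = c₃`.
  have h1 : s * (randersPhi c₁ c₂ c₃ s * ((c₁ * c₃ - c₂ ^ 2) / randersPhi c₁ c₂ c₃ s ^ 3)
      + (c₂ + c₃ * s) / randersPhi c₁ c₂ c₃ s * ((c₂ + c₃ * s) / randersPhi c₁ c₂ c₃ s))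
      - randersPhi c₁ c₂ c₃ s * ((c₂ + c₃ * s) / randersPhi c₁ c₂ c₃ s) = -c₂ := by
    field_simp
    rw [hsq]
    ring
  rw [h1]
  ring

end Scalar

/-! ### Contractions of `Sym(h ⊗ m)` and inversion of the Gram matrix. -/

section MatrixPart

open Matrix

variable {ι : Type*} [Fintype ι]

/-- The symmetrization of `h ⊗ m`. -/
def symProd (h : Matrix ι ι ℝ) (m : ι → ℝ) (i j k : ι) : ℝ :=
  h i j * m k + h j k * m i + h i k * m j

/-- One of the three terms pairs `H` with both slots of `h` and gives the trace; the other two each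
give `h H m`. -/
theorem sum_symProd_trace {H : Matrix ι ι ℝ} (hH : Hᵀ = H) (h : Matrix ι ι ℝ) (m : ι → ℝ) (i : ι) :
    ∑ j, ∑ k, H j k * symProd h m i j k = trace (h * H) * m i + 2 * (h *ᵥ (H *ᵥ m)) i := by
  have hHs : ∀ i j, H i j = H j i := fun i j => congrFun (congrFun hH j) i
  have h1 : ∑ j, ∑ k, H j k * (h i j * m k) = (h *ᵥ (H *ᵥ m)) i := by
    simp only [mulVec, dotProduct, Finset.mul_sum]
    exact Finset.sum_congr rfl fun j _ => Finset.sum_congr rfl fun k _ => by ring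
  have h2 : ∑ j, ∑ k, H j k * (h j k * m i) = trace (h * H) * m i := by
    simp only [trace, diag, mul_apply, Finset.sum_mul]
    exact Finset.sum_congr rfl fun j _ => Finset.sum_congr rfl fun k _ => by
      rw [hHs j k]; ring
  have h3 : ∑ j, ∑ k, H j k * (h i k * m j) = (h *ᵥ (H *ᵥ m)) i := by
    rw [← h1, Finset.sum_comm]
    exact Finset.sum_congr rfl fun j _ => Finset.sum_congr rfl fun k _ => by rw [hHs]
  simp only [symProd, mul_add, Finset.sum_add_distrib, h1, h2, h3]
  ring

theorem sum_raise_symProd {H h : Matrix ι ι ℝ} (hH : Hᵀ = H) (hh : hᵀ = h) (m : ι → ℝ)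
    (i j k : ι) :
    ∑ l, H i l * ∑ r, H j r * ∑ t, H k t * symProd h m l r t
      = symProd (H * h * H) (H *ᵥ m) i j k := by
  have hHs : ∀ i j, H i j = H j i := fun i j => congrFun (congrFun hH j) i
  have hhs : ∀ i j, h i j = h j i := fun i j => congrFun (congrFun hh j) i
  have e1 : ∀ l r, ∑ t, H k t * symProd h m l r t
      = h l r * (H *ᵥ m) k + (H * h) k r * m l + (H * h) k l * m r := by
    intro l r
    simp only [symProd, mulVec, dotProduct, mul_apply, Finset.mul_sum, Finset.sum_mul,
      ← Finset.sum_add_distrib]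
    exact Finset.sum_congr rfl fun t _ => by rw [hhs r t, hhs l t]; ring
  have e2 : ∀ l, ∑ r, H j r * (h l r * (H *ᵥ m) k + (H * h) k r * m l + (H * h) k l * m r)
      = (H * h) j l * (H *ᵥ m) k + (H * h * H) j k * m l + (H * h) k l * (H *ᵥ m) j := by
    intro l
    have : (H * h * H) j k = (H * h * H) k j := by
      have h1 : (H * h * H)ᵀ = H * h * H := by
        rw [transpose_mul, transpose_mul, hH, hh, Matrix.mul_assoc]
      exact congrFun (congrFun h1 k) j
    have h1 : (H * h) j l = ∑ r, H j r * h l r := by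
      rw [mul_apply]
      exact Finset.sum_congr rfl fun t _ => by rw [hhs l t]
    have h2 : (H * h * H) j k = ∑ r, H j r * (H * h) k r := by
      rw [this, mul_apply]
      exact Finset.sum_congr rfl fun t _ => by rw [hHs j t, mul_comm]
    have h3 : (H *ᵥ m) j = ∑ r, H j r * m r := rfl
    rw [h1, h2, h3]
    simp only [Finset.mul_sum, Finset.sum_mul, ← Finset.sum_add_distrib]
    exact Finset.sum_congr rfl fun t _ => by ring
  have e3 : ∑ l, H i l * ((H * h) j l * (H *ᵥ m) k + (H * h * H) j k * m l
        + (H * h) k l * (H *ᵥ m) j) = symProd (H * h * H) (H *ᵥ m) i j k := by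
    have hs : ∀ a b, (H * h * H) a b = ∑ l, H a l * (H * h) b l := by
      intro a b
      have h1 : (H * h * H)ᵀ = H * h * H := by
        rw [transpose_mul, transpose_mul, hH, hh, Matrix.mul_assoc]
      rw [show (H * h * H) a b = (H * h * H) b a from congrFun (congrFun h1 b) a,
        mul_apply (M := H * h) (N := H)]
      exact Finset.sum_congr rfl fun t _ => by rw [hHs a t]; ring
    have hv : (H *ᵥ m) i = ∑ l, H i l * m l := rfl
    rw [symProd, hs i j, hs i k, hv]
    simp only [Finset.mul_sum, Finset.sum_mul, ← Finset.sum_add_distrib]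
    exact Finset.sum_congr rfl fun t _ => by ring
  simp only [e1, e2, e3]

/-- The second factor is totally symmetric, so the three terms of the first contribute equally. -/
theorem sum_symProd_mul_symProd {h K : Matrix ι ι ℝ} (hK : Kᵀ = K) (m v : ι → ℝ) :
    ∑ i, ∑ j, ∑ k, symProd h m i j k * symProd K v i j k
      = 3 * ∑ i, ∑ j, h i j * (K i j * (m ⬝ᵥ v) + (K *ᵥ m) j * v i + (K *ᵥ m) i * v j) := by
  have hKs : ∀ i j, K i j = K j i := fun i j => congrFun (congrFun hK j) i
  have e1 : ∑ i, ∑ j, ∑ k, h i j * m k * symProd K v i j k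
      = ∑ i, ∑ j, h i j * (K i j * (m ⬝ᵥ v) + (K *ᵥ m) j * v i + (K *ᵥ m) i * v j) := by
    refine Finset.sum_congr rfl fun i _ => Finset.sum_congr rfl fun j _ => ?_
    simp only [symProd, mulVec, dotProduct, Finset.mul_sum, Finset.sum_mul,
      ← Finset.sum_add_distrib]
    exact Finset.sum_congr rfl fun k _ => by ring
  have e2 : ∑ i, ∑ j, ∑ k, h j k * m i * symProd K v i j k
      = ∑ i, ∑ j, ∑ k, h i j * m k * symProd K v i j k := by
    rw [Finset.sum_comm]
    refine Finset.sum_congr rfl fun i _ => ?_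
    rw [Finset.sum_comm]
    refine Finset.sum_congr rfl fun j _ => Finset.sum_congr rfl fun k _ => ?_
    simp only [symProd, hKs k i, hKs k j]
    ring
  have e3 : ∑ i, ∑ j, ∑ k, h i k * m j * symProd K v i j k
      = ∑ i, ∑ j, ∑ k, h i j * m k * symProd K v i j k := by
    refine Finset.sum_congr rfl fun i _ => ?_
    rw [Finset.sum_comm]
    refine Finset.sum_congr rfl fun j _ => Finset.sum_congr rfl fun k _ => ?_
    simp only [symProd, hKs k j]
    ring
  rw [← e1]
  have : ∀ i j k, symProd h m i j k * symProd K v i j k = h i j * m k * symProd K v i j k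
      + h j k * m i * symProd K v i j k + h i k * m j * symProd K v i j k := by
    intro i j k
    rw [symProd]
    ring
  simp only [this, Finset.sum_add_distrib, e2, e3]
  ring

/-- The square of the norm of `h ⊗ m` symmetrized, when `m` is an eigenvector of `h H`. -/
theorem sum_symProd_normSq {H h : Matrix ι ι ℝ} (hH : Hᵀ = H) (hh : hᵀ = h) {m : ι → ℝ} {ρ : ℝ}
    (hm : h *ᵥ (H *ᵥ m) = ρ • m) :
    ∑ i, ∑ j, ∑ k, ∑ l, ∑ r, ∑ t,
      H i l * H j r * H k t * symProd h m i j k * symProd h m l r t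
      = 3 * (trace (h * H * (h * H)) + 2 * ρ ^ 2) * (m ⬝ᵥ H *ᵥ m) := by
  have e0 : ∀ i j k, ∑ l, ∑ r, ∑ t,
      H i l * H j r * H k t * symProd h m i j k * symProd h m l r t
      = symProd h m i j k * symProd (H * h * H) (H *ᵥ m) i j k := by
    intro i j k
    rw [← sum_raise_symProd hH hh]
    simp only [Finset.mul_sum]
    exact Finset.sum_congr rfl fun l _ => Finset.sum_congr rfl fun r _ =>
      Finset.sum_congr rfl fun t _ => by ring
  have hK : (H * h * H)ᵀ = H * h * H := by
    rw [transpose_mul, transpose_mul, hH, hh, Matrix.mul_assoc]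
  have hKm : (H * h * H) *ᵥ m = ρ • (H *ᵥ m) := by
    rw [← mulVec_mulVec, ← mulVec_mulVec, hm, mulVec_smul]
  simp only [e0]
  rw [sum_symProd_mul_symProd hK, hKm]
  have e1 : ∑ i, ∑ j, h i j * (H * h * H) i j = trace (h * H * (h * H)) := by
    rw [show h * H * (h * H) = h * (H * h * H) by simp only [Matrix.mul_assoc]]
    simp only [trace, diag, mul_apply (M := h)]
    exact Finset.sum_congr rfl fun i _ => Finset.sum_congr rfl fun j _ => by
      rw [show (H * h * H) i j = (H * h * H) j i from congrFun (congrFun hK j) i]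
  have e2 : ∑ i, ∑ j, h i j * ((H *ᵥ m) j * (H *ᵥ m) i) = ρ * (m ⬝ᵥ H *ᵥ m) := by
    have : (ρ • m) ⬝ᵥ (H *ᵥ m) = ρ * (m ⬝ᵥ H *ᵥ m) := by rw [smul_dotProduct, smul_eq_mul]
    rw [← this, ← hm]
    generalize H *ᵥ m = v
    simp only [mulVec, dotProduct, Finset.sum_mul]
    exact Finset.sum_congr rfl fun i _ => Finset.sum_congr rfl fun j _ => by ring
  have e3 : ∀ i j, h i j * ((H * h * H) i j * (m ⬝ᵥ H *ᵥ m) + (ρ • (H *ᵥ m)) j * (H *ᵥ m) i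
      + (ρ • (H *ᵥ m)) i * (H *ᵥ m) j) = h i j * (H * h * H) i j * (m ⬝ᵥ H *ᵥ m)
      + 2 * ρ * (h i j * ((H *ᵥ m) j * (H *ᵥ m) i)) := by
    intro i j
    simp only [Pi.smul_apply, smul_eq_mul]
    ring
  simp only [e3, Finset.sum_add_distrib, ← Finset.mul_sum, ← Finset.sum_mul, e1, e2]
  ring

variable [DecidableEq ι]

/-- A Gram matrix `G = T h + ψ l² + 2 k l m + c m²`, where `h` annihilates `x`, and `x`, `z` are
dual to `l`, `m`. -/
structure IsRandersGram (G h : Matrix ι ι ℝ) (l m x z : ι → ℝ) (T ψ k c μ w : ℝ) : Prop where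
  isUnit_det : IsUnit G.det
  h_symm : hᵀ = h
  eq : G = T • h + ψ • vecMulVec l l + k • (vecMulVec l m + vecMulVec m l) + c • vecMulVec m m
  h_x : h *ᵥ x = 0
  h_z : h *ᵥ z = m
  l_x : l ⬝ᵥ x = 1
  m_x : m ⬝ᵥ x = 0
  l_z : l ⬝ᵥ z = 0
  m_z : m ⬝ᵥ z = μ
  T_pos : 0 < T
  ψ_pos : 0 < ψ
  w_eq : w = T * ψ + μ * (c * ψ - k ^ 2)
  w_pos : 0 < w

namespace IsRandersGram

variable {G h : Matrix ι ι ℝ} {l m x z : ι → ℝ} {T ψ k c μ w : ℝ}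

theorem G_symm (H : IsRandersGram G h l m x z T ψ k c μ w) : Gᵀ = G := by
  rw [H.eq]
  simp only [transpose_add, transpose_smul, H.h_symm, transpose_vecMulVec]
  rw [add_comm (vecMulVec l m)]

theorem inv_symm (H : IsRandersGram G h l m x z T ψ k c μ w) : G⁻¹ᵀ = G⁻¹ := by
  rw [transpose_nonsing_inv, H.G_symm]

theorem G_mulVec (H : IsRandersGram G h l m x z T ψ k c μ w) (v : ι → ℝ) :
    G *ᵥ v = T • (h *ᵥ v) + (ψ * (l ⬝ᵥ v) + k * (m ⬝ᵥ v)) • l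
      + (k * (l ⬝ᵥ v) + c * (m ⬝ᵥ v)) • m := by
  rw [H.eq]
  simp only [add_mulVec, smul_mulVec, vecMulVec_mulVec]
  ext i
  simp
  ring

theorem inv_mulVec_of_eq (H : IsRandersGram G h l m x z T ψ k c μ w) {u v : ι → ℝ}
    (huv : G *ᵥ u = v) : G⁻¹ *ᵥ v = u := by
  rw [← huv, mulVec_mulVec, nonsing_inv_mul _ H.isUnit_det, one_mulVec]

/-- On the span of `x` and `z`, `G x = ψ l + k m` and `G z = kμ l + (T + cμ) m`. The combination `ψ
z - kμ x` cancels `l` and leaves `w m`. -/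
theorem inv_mulVec_m (H : IsRandersGram G h l m x z T ψ k c μ w) :
    G⁻¹ *ᵥ m = w⁻¹ • (ψ • z - (k * μ) • x) := by
  apply H.inv_mulVec_of_eq
  have hw := H.w_pos
  rw [mulVec_smul, mulVec_sub, mulVec_smul, mulVec_smul, H.G_mulVec, H.G_mulVec, H.h_x, H.h_z,
    H.l_x, H.m_x, H.l_z, H.m_z]
  ext i
  simp
  field_simp
  rw [H.w_eq]
  ring

theorem inv_mulVec_l (H : IsRandersGram G h l m x z T ψ k c μ w) :
    G⁻¹ *ᵥ l = ψ⁻¹ • (x - k • (G⁻¹ *ᵥ m)) := by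
  apply H.inv_mulVec_of_eq
  have hψ := H.ψ_pos
  rw [mulVec_smul, mulVec_sub, mulVec_smul, mulVec_mulVec, mul_nonsing_inv _ H.isUnit_det,
    one_mulVec, H.G_mulVec, H.h_x, H.l_x, H.m_x]
  ext i
  simp
  field_simp

/-- Supplies the eigenvector hypothesis of `sum_symProd_normSq`, with `ρ = ψ/w`. -/
theorem h_inv_mulVec_m (H : IsRandersGram G h l m x z T ψ k c μ w) :
    h *ᵥ (G⁻¹ *ᵥ m) = (ψ / w) • m := by
  rw [H.inv_mulVec_m, mulVec_smul, mulVec_sub, mulVec_smul, mulVec_smul, H.h_x, H.h_z]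
  ext i
  simp
  ring

theorem h_inv_mulVec_l (H : IsRandersGram G h l m x z T ψ k c μ w) :
    h *ᵥ (G⁻¹ *ᵥ l) = (-(k / ψ) * (ψ / w)) • m := by
  rw [H.inv_mulVec_l, mulVec_smul, mulVec_sub, mulVec_smul, H.h_x, H.h_inv_mulVec_m]
  ext i
  simp
  ring

theorem m_inv_m (H : IsRandersGram G h l m x z T ψ k c μ w) :
    m ⬝ᵥ G⁻¹ *ᵥ m = ψ / w * μ := by
  rw [H.inv_mulVec_m]
  simp only [dotProduct_smul, dotProduct_sub, H.m_x, H.m_z, smul_eq_mul]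
  ring

theorem l_inv_m (H : IsRandersGram G h l m x z T ψ k c μ w) :
    l ⬝ᵥ G⁻¹ *ᵥ m = -(k * μ / w) := by
  rw [H.inv_mulVec_m]
  simp only [dotProduct_smul, dotProduct_sub, H.l_x, H.l_z, smul_eq_mul]
  ring

theorem m_inv_l (H : IsRandersGram G h l m x z T ψ k c μ w) :
    m ⬝ᵥ G⁻¹ *ᵥ l = -(k * μ / w) := by
  have hψ := H.ψ_pos
  rw [H.inv_mulVec_l]
  simp only [dotProduct_smul, dotProduct_sub, H.m_x, H.m_inv_m, smul_eq_mul]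
  field_simp
  ring

theorem l_inv_l (H : IsRandersGram G h l m x z T ψ k c μ w) :
    l ⬝ᵥ G⁻¹ *ᵥ l = (1 + k ^ 2 * μ / w) / ψ := by
  have hψ := H.ψ_pos
  rw [H.inv_mulVec_l]
  simp only [dotProduct_smul, dotProduct_sub, H.l_x, H.l_inv_m, smul_eq_mul]
  field_simp
  ring

/-- `T h` differs from `G` by rank-one terms, so `T h G⁻¹` is the identity minus rank-one terms,
whose traces are pairings of `l`, `m` with `G⁻¹ l`, `G⁻¹ m`. This yields both traces below without
diagonalizing. -/
theorem smul_h_mul_inv (H : IsRandersGram G h l m x z T ψ k c μ w) :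
    T • (h * G⁻¹) = 1 - ψ • vecMulVec l (G⁻¹ *ᵥ l)
      - k • (vecMulVec l (G⁻¹ *ᵥ m) + vecMulVec m (G⁻¹ *ᵥ l)) - c • vecMulVec m (G⁻¹ *ᵥ m) := by
  have hv : ∀ v, v ᵥ* G⁻¹ = G⁻¹ *ᵥ v := fun v => by
    rw [← vecMul_transpose, H.inv_symm]
  have h1 : T • h = G - ψ • vecMulVec l l - k • (vecMulVec l m + vecMulVec m l)
      - c • vecMulVec m m := by
    rw [H.eq]
    abel
  rw [← Matrix.smul_mul, h1]
  simp only [Matrix.sub_mul, Matrix.smul_mul, Matrix.add_mul, vecMulVec_mul, hv,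
    mul_nonsing_inv _ H.isUnit_det]

theorem trace_h_inv (H : IsRandersGram G h l m x z T ψ k c μ w) :
    trace (h * G⁻¹) = ((Fintype.card ι : ℝ) - 2) / T + ψ / w := by
  have hT := H.T_pos
  have hψ := H.ψ_pos
  have hw := H.w_pos
  have h1 := congrArg trace H.smul_h_mul_inv
  simp only [trace_smul, trace_sub, trace_add, trace_one, trace_vecMulVec, smul_eq_mul, H.l_inv_l,
    H.l_inv_m, H.m_inv_l, H.m_inv_m] at h1
  have h2 : trace (h * G⁻¹) = T * trace (h * G⁻¹) / T := by field_simp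
  rw [h2, h1]
  field_simp
  rw [H.w_eq]
  ring

theorem trace_h_inv_sq (H : IsRandersGram G h l m x z T ψ k c μ w) :
    trace (h * G⁻¹ * (h * G⁻¹)) = ((Fintype.card ι : ℝ) - 2) / T ^ 2
      + (ψ / w) ^ 2 := by
  have hT := H.T_pos
  have hψ := H.ψ_pos
  have hw := H.w_pos
  have h1 := congrArg (fun N => trace (h * G⁻¹ * N)) H.smul_h_mul_inv
  simp only [Matrix.mul_sub, Matrix.mul_add, Matrix.mul_smul, mul_vecMulVec, Matrix.mul_one,
    ← mulVec_mulVec, H.h_inv_mulVec_m, H.h_inv_mulVec_l, smul_vecMulVec,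
    trace_smul, trace_sub, trace_add, trace_vecMulVec, smul_eq_mul,
    H.m_inv_l, H.m_inv_m, H.trace_h_inv] at h1
  have h2 : trace (h * G⁻¹ * (h * G⁻¹)) = T * trace (h * G⁻¹ * (h * G⁻¹)) / T := by field_simp
  rw [h2, h1]
  field_simp
  rw [H.w_eq]
  ring

end IsRandersGram

end MatrixPart

open Matrix

/-! ### Passage between bilinear forms and their matrices in a basis. -/

section BasisMatrix

variable {V : Type*} [AddCommGroup V] [Module ℝ V] {ι : Type*} [Fintype ι]
  (e : Module.Basis ι ℝ V)

theorem dotProduct_equivFun (f : V →ₗ[ℝ] ℝ) (u : V) :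
    (fun i => f (e i)) ⬝ᵥ e.equivFun u = f u := by
  conv_rhs => rw [← e.sum_equivFun u]
  simp only [map_sum, map_smul, smul_eq_mul, dotProduct, mul_comm]

theorem of_mulVec_equivFun (b : LinearMap.BilinForm ℝ V) (u : V) :
    (Matrix.of fun i j => b (e i) (e j)) *ᵥ e.equivFun u = fun i => b (e i) u :=
  funext fun i => dotProduct_equivFun e (b (e i)) u

variable [DecidableEq ι]

theorem isUnit_det_of_posDef {b : LinearMap.BilinForm ℝ V} (hpos : ∀ u, u ≠ 0 → 0 < b u u) :
    IsUnit (Matrix.of fun i j => b (e i) (e j)).det := by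
  rw [isUnit_iff_ne_zero]
  intro h0
  obtain ⟨v, hv, h⟩ := Matrix.exists_mulVec_eq_zero_iff.2 h0
  obtain ⟨u, rfl⟩ := e.equivFun.surjective v
  have hu : u ≠ 0 := fun h => hv (by simp [h])
  rw [of_mulVec_equivFun] at h
  have h1 := dotProduct_equivFun e (b.flip u) u
  rw [show (fun i => b.flip u (e i)) = fun i => b (e i) u from rfl, h, zero_dotProduct] at h1
  exact (hpos u hu).ne h1

theorem exists_dual_vector {a : LinearMap.BilinForm ℝ V} (hpos : ∀ u, u ≠ 0 → 0 < a u u)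
    (β : V →ₗ[ℝ] ℝ) :
    ∃ b : V, (∀ v, a v b = β v) ∧ covectorNormSq (fun u v => a u v) (fun u => β u) e = β b := by
  obtain ⟨b, hb⟩ := e.equivFun.surjective
    ((Matrix.of fun i j => a (e i) (e j))⁻¹ *ᵥ fun i => β (e i))
  refine ⟨b, fun v => ?_, ?_⟩
  · have h1 := of_mulVec_equivFun e a b
    rw [hb, mulVec_mulVec, mul_nonsing_inv _ (isUnit_det_of_posDef e hpos), one_mulVec] at h1
    have h2 : a.flip b = β := e.ext fun i => (congrFun h1 i).symm
    exact congrArg (fun f => f v) h2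
  · rw [← dotProduct_equivFun e β b, hb]
    simp only [covectorNormSq, dotProduct, mulVec, Finset.mul_sum]
    exact Finset.sum_congr rfl fun i _ => Finset.sum_congr rfl fun j _ => by ring

theorem exists_ne_zero_apply_eq_zero {ι : Type*} [Fintype ι] (e : Module.Basis ι ℝ V)
    (hn : 2 ≤ Fintype.card ι) (f : V →ₗ[ℝ] ℝ) :
    ∃ u, u ≠ 0 ∧ f u = 0 := by
  obtain ⟨i, j, hij⟩ := Fintype.one_lt_card_iff.1 (show 1 < Fintype.card ι by omega)
  by_cases hi : f (e i) = 0
  · exact ⟨e i, e.ne_zero i, hi⟩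
  · refine ⟨f (e j) • e i - f (e i) • e j, fun h => hi ?_, ?_⟩
    · have h1 := congrArg (fun v => e.repr v j) h
      simpa [Finsupp.single_apply, hij] using h1
    · simp; ring

end BasisMatrix

/-! ### Positivity of `F` and of `c₁ + c₂ s`; decomposition of `g`. -/

section Randers

variable {V : Type*} [AddCommGroup V] [Module ℝ V] {a : LinearMap.BilinForm ℝ V}
  {β : V →ₗ[ℝ] ℝ} {c₁ c₂ c₃ : ℝ} {F : V → ℝ}

/-- If `F y = 0`, homogeneity makes `F` vanish along the ray of `y`, which forces `g_y(y,y) = 0`. -/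
theorem pos_of_posDef_fundamentalTensor (hnonneg : ∀ v, 0 ≤ F v)
    (hhom : ∀ v, ∀ r : ℝ, 0 < r → F (r • v) = r * F v) {y : V}
    (hy : 0 < fundamentalTensor F y y y) : 0 < F y := by
  refine lt_of_le_of_ne (hnonneg y) fun h0 => hy.ne' ?_
  have hE : (fun s : ℝ => deriv (fun t : ℝ => F (y + s • y + t • y) ^ 2) 0) =ᶠ[nhds 0]
      fun _ => 0 := by
    -- Both parameters stay above `-1/2`, so that `1 + s + t > 0` and positive homogeneity applies.
    filter_upwards [lt_mem_nhds (show (-1 / 2 : ℝ) < 0 by norm_num)] with s hs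
    have hE' : (fun t : ℝ => F (y + s • y + t • y) ^ 2) =ᶠ[nhds 0] fun _ => 0 := by
      filter_upwards [lt_mem_nhds (show (-1 / 2 : ℝ) < 0 by norm_num)] with t ht
      rw [show y + s • y + t • y = (1 + s + t) • y by rw [add_smul, add_smul, one_smul],
        hhom _ _ (by linarith), ← h0]
      ring
    rw [hE'.deriv_eq]
    simp
  rw [fundamentalTensor, hE.deriv_eq]
  simp

/-- For `β ≠ 0`, take `u ≠ 0` orthogonal to the dual vector `b`: positivity of `g(u,u)` at the base
points `b` and `-b` says `c₁ ± c₂ ‖β‖ > 0`. The expression is affine in `s` and `|s| ≤ ‖β‖`, so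
positivity at the endpoints suffices. -/
theorem randers_T_pos (hsymm : ∀ u v, a u v = a v u) (hpos : ∀ z, z ≠ 0 → 0 < a z z)
    (hF : ∀ z, F z ^ 2 = randersSq c₁ c₂ c₃ a β z)
    (hFpos : ∀ z, z ≠ 0 → 0 < F z)
    (hg : ∀ y, y ≠ 0 → ∀ u, u ≠ 0 → 0 < fundamentalTensor F y u u)
    (hperp : ∀ f : V →ₗ[ℝ] ℝ, ∃ u, u ≠ 0 ∧ f u = 0) {b : V} (hb : ∀ v, a v b = β v)
    {y : V} (hy : y ≠ 0) {s : ℝ} (hs : s = β y / √(a y y)) (hsB : s ^ 2 ≤ β b) :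
    0 < c₁ + c₂ * s := by
  by_cases hb0 : b = 0
  · have hβ : β y = 0 := by rw [← hb, hb0, map_zero]
    have h1 := pow_pos (hFpos y hy) 2
    rw [hF, randersSq, hβ] at h1
    have h2 := hpos y hy
    rw [hs, hβ]
    simp at h1 ⊢
    exact pos_of_mul_pos_left h1 h2.le
  · have hB : 0 < β b := by rw [← hb]; exact hpos b hb0
    obtain ⟨u, hu, hu0⟩ := hperp (a b)
    have hβu : β u = 0 := by rw [← hb, hsymm, hu0]
    have hr := Real.sqrt_pos.2 hB
    have hrr := Real.mul_self_sqrt hB.le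
    have hau := hpos u hu
    have h1 := hg b hb0 u hu
    rw [fundamentalTensor_randers hsymm hpos hF hb0, hu0, hβu, hb] at h1
    have h2 := hg (-b) (neg_ne_zero.2 hb0) u hu
    rw [fundamentalTensor_randers hsymm hpos hF (neg_ne_zero.2 hb0)] at h2
    simp only [map_neg, LinearMap.neg_apply, neg_neg, hu0, hβu, hb] at h2
    have e1 : 0 < (c₁ + c₂ * √(β b)) * a u u := by
      convert h1 using 1
      have : β b * a u u / √(β b) = √(β b) * a u u := by
        rw [div_eq_iff hr.ne']; linear_combination (-a u u) * hrr
      rw [this]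
      ring
    have e2 : 0 < (c₁ - c₂ * √(β b)) * a u u := by
      convert h2 using 1
      have : -β b * a u u / √(β b) = -(√(β b) * a u u) := by
        rw [div_eq_iff hr.ne']; linear_combination (a u u) * hrr
      rw [this]
      ring
    have f1 := pos_of_mul_pos_left e1 hau.le
    have f2 := pos_of_mul_pos_left e2 hau.le
    have hs' := abs_le.1 (Real.abs_le_sqrt hsB)
    rcases le_total 0 c₂ with hc | hc
    · nlinarith [mul_le_mul_of_nonneg_left hs'.1 hc]
    · nlinarith [mul_le_mul_of_nonpos_left hs'.2 hc]

/-- The decomposition of the fundamental tensor of a generalized Randers metric. -/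
theorem fundamentalTensor_randers_eq (hsymm : ∀ u v, a u v = a v u) (hpos : ∀ z, z ≠ 0 → 0 < a z z)
    (hF : ∀ z, F z ^ 2 = randersSq c₁ c₂ c₃ a β z)
    {y : V} (hy : y ≠ 0) {s : ℝ} (hs : s = β y / √(a y y)) (u v : V) {l m : V → ℝ}
    (hl : ∀ u, l u = a y u / √(a y y)) (hm : ∀ u, m u = β u - s * l u) :
    fundamentalTensor F y u v = (c₁ + c₂ * s) * (a u v - l u * l v)
      + (c₁ + 2 * c₂ * s + c₃ * s ^ 2) * (l u * l v)
      + (c₂ + c₃ * s) * (l u * m v + m u * l v) + c₃ * (m u * m v) := by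
  have hr := Real.sqrt_pos.2 (hpos y hy)
  rw [fundamentalTensor_randers hsymm hpos hF hy, hm, hm, hl, hl, hs]
  field_simp
  ring

theorem randersSq_eq (hpos : ∀ z, z ≠ 0 → 0 < a z z) {y : V} (hy : y ≠ 0) {s : ℝ} (hs : s = β y / √(a y y)) :
    randersSq c₁ c₂ c₃ a β y = √(a y y) ^ 2 * (c₁ + 2 * c₂ * s + c₃ * s ^ 2) := by
  have h0 := hpos y hy
  have hr := Real.sqrt_pos.2 h0
  have hβ : β y = s * √(a y y) := by rw [hs]; field_simp
  rw [randersSq, hβ, show a y y = √(a y y) ^ 2 from (Real.sq_sqrt h0.le).symm,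
    Real.sqrt_sq hr.le]
  ring

end Randers

/-! ### The frame adapted to `y` and `β`. -/

section Frame

variable {V : Type*} [AddCommGroup V] [Module ℝ V]

/-- The vectors dual to `l = a(y, ·)/α` and `m = β - s l`, and the angular form `h = a - l²`. -/
structure IsAngularFrame (a : LinearMap.BilinForm ℝ V) (β : V →ₗ[ℝ] ℝ) (y : V) (s B : ℝ)
    (h : LinearMap.BilinForm ℝ V) (l m : V →ₗ[ℝ] ℝ) (x z : V) : Prop where
  l_eq : ∀ u, l u = a y u / √(a y y)
  m_eq : ∀ u, m u = β u - s * l u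
  h_eq : ∀ u v, h u v = a u v - l u * l v
  h_x : ∀ u, h u x = 0
  h_z : ∀ u, h u z = m u
  l_x : l x = 1
  m_x : m x = 0
  l_z : l z = 0
  m_z : m z = B - s ^ 2

variable {a : LinearMap.BilinForm ℝ V} {β : V →ₗ[ℝ] ℝ}

theorem exists_isAngularFrame (hsymm : ∀ u v, a u v = a v u) {b y : V} (hb : ∀ v, a v b = β v)
    (hy : 0 < a y y) {s : ℝ} (hs : s = β y / √(a y y)) :
    ∃ h l m x z, IsAngularFrame a β y s (β b) h l m x z := by
  have hr := Real.sqrt_pos.2 hy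
  have hrr := Real.mul_self_sqrt hy.le
  set r := √(a y y) with hr_def
  have hl : ∀ u, (r⁻¹ • a y) u = a y u / r := fun u => by
    simp only [LinearMap.smul_apply, smul_eq_mul]
    rw [div_eq_inv_mul]
  have hβx : β (r⁻¹ • y) = s := by rw [hs, map_smul, smul_eq_mul, div_eq_inv_mul]
  have hβy : β y = s * r := by rw [hs]; field_simp
  -- `x` is `y` normalized for `α`, and `z` is the component of the dual vector `b` orthogonal to
  -- `y`; `z` may be zero.
  refine ⟨a - LinearMap.BilinForm.linMulLin (r⁻¹ • a y) (r⁻¹ • a y), r⁻¹ • a y,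
    β - s • (r⁻¹ • a y), r⁻¹ • y, b - s • (r⁻¹ • y), ?_⟩
  have hlx : (r⁻¹ • a y) (r⁻¹ • y) = 1 := by
    rw [hl, map_smul, smul_eq_mul, ← hrr]; field_simp
  have hlb : (r⁻¹ • a y) b = s := by rw [hl, hb, hβy]; field_simp
  have hlz : (r⁻¹ • a y) (b - s • (r⁻¹ • y)) = 0 := by
    rw [map_sub, map_smul, hlx, hlb]; simp
  have hax : ∀ u, a u (r⁻¹ • y) = (r⁻¹ • a y) u := fun u => by
    rw [hl, map_smul, hsymm, smul_eq_mul, div_eq_inv_mul]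
  constructor
  · exact hl
  · intro u; rfl
  · intro u v
    simp only [LinearMap.sub_apply, LinearMap.BilinForm.linMulLin_apply]
  · intro u
    rw [LinearMap.sub_apply, LinearMap.sub_apply, LinearMap.BilinForm.linMulLin_apply, hax, hlx]
    ring
  · intro u
    rw [LinearMap.sub_apply, LinearMap.sub_apply, LinearMap.BilinForm.linMulLin_apply, hlz,
      map_sub, map_smul, hax, hb]
    simp only [LinearMap.sub_apply, LinearMap.smul_apply, smul_eq_mul]
    ring
  · exact hlx
  · rw [LinearMap.sub_apply, LinearMap.smul_apply, hlx, hβx]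
    simp
  · exact hlz
  · rw [LinearMap.sub_apply, LinearMap.smul_apply, hlz, map_sub, map_smul, hβx]
    simp
    ring

end Frame

/-! ### Positivity of `w` and the two norms on one tangent space. -/

section Pointwise

variable {V : Type*} [AddCommGroup V] [Module ℝ V] {a : LinearMap.BilinForm ℝ V}
  {β : V →ₗ[ℝ] ℝ} {c₁ c₂ c₃ s B : ℝ} {F : V → ℝ} {y : V}
  {h : LinearMap.BilinForm ℝ V} {l m : V →ₗ[ℝ] ℝ} {x z : V}

theorem IsAngularFrame.eq_apply_z (H : IsAngularFrame a β y s B h l m x z) :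
    B - s ^ 2 = a z z := by
  have h1 := H.h_eq z z
  rw [H.h_z, H.m_z, H.l_z] at h1
  linarith

theorem IsAngularFrame.nonneg (H : IsAngularFrame a β y s B h l m x z)
    (hpos : ∀ z, z ≠ 0 → 0 < a z z) : 0 ≤ B - s ^ 2 := by
  rw [H.eq_apply_z]
  by_cases hz : z = 0
  · simp [hz]
  · exact (hpos z hz).le

/-- If `μ = 0` then `w = Tψ`. Otherwise the test vector `u = ψ z - kμ x`, a multiple of the `g`-dual
of `m`, gives `g(u,u) = ψ μ w`. -/
theorem randers_w_pos (H : IsAngularFrame a β y s B h l m x z)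
    (hsymm : ∀ u v, a u v = a v u) (hpos : ∀ z, z ≠ 0 → 0 < a z z)
    (hF : ∀ z, F z ^ 2 = randersSq c₁ c₂ c₃ a β z)
    (hg : ∀ y, y ≠ 0 → ∀ u, u ≠ 0 → 0 < fundamentalTensor F y u u)
    (hy : y ≠ 0) (hs : s = β y / √(a y y))
    (hψ : 0 < c₁ + 2 * c₂ * s + c₃ * s ^ 2) (hT : 0 < c₁ + c₂ * s) :
    0 < (c₁ + c₂ * s) * (c₁ + 2 * c₂ * s + c₃ * s ^ 2) + (B - s ^ 2) * (c₁ * c₃ - c₂ ^ 2) := by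
  rcases (H.nonneg hpos).eq_or_lt with h0 | h0
  · rw [← h0, zero_mul, add_zero]
    exact mul_pos hT hψ
  · set ψ := c₁ + 2 * c₂ * s + c₃ * s ^ 2 with hψ_def
    set u := ψ • z - ((c₂ + c₃ * s) * (B - s ^ 2)) • x with hu_def
    have hmu : m u = ψ * (B - s ^ 2) := by
      simp [hu_def, H.m_z, H.m_x]
    have hlu : l u = -((c₂ + c₃ * s) * (B - s ^ 2)) := by
      simp [hu_def, H.l_z, H.l_x]
    have hhu : h u u = ψ ^ 2 * (B - s ^ 2) := by
      have : h u u = ψ * h u z - ((c₂ + c₃ * s) * (B - s ^ 2)) * h u x := by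
        conv_lhs => rw [hu_def, map_sub, map_smul, map_smul]
        rfl
      rw [this, H.h_z, H.h_x, hmu]
      ring
    have hu : u ≠ 0 := by
      intro hu
      rw [hu, map_zero] at hmu
      exact (mul_pos hψ h0).ne hmu
    have h1 := hg y hy u hu
    rw [fundamentalTensor_randers_eq hsymm hpos hF hy hs u u H.l_eq H.m_eq, ← H.h_eq, hmu, hlu,
      hhu, ← hψ_def] at h1
    refine pos_of_mul_pos_left (b := ψ * (B - s ^ 2)) ?_ (mul_pos hψ h0).le
    refine h1.trans_eq ?_
    rw [hψ_def]
    ring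

variable {ι : Type*} [Fintype ι] [DecidableEq ι] (e : Module.Basis ι ℝ V)

theorem isRandersGram_gramMatrix (H : IsAngularFrame a β y s B h l m x z)
    (hsymm : ∀ u v, a u v = a v u) (hpos : ∀ z, z ≠ 0 → 0 < a z z)
    (hF : ∀ z, F z ^ 2 = randersSq c₁ c₂ c₃ a β z)
    (hg : ∀ y, y ≠ 0 → ∀ u, u ≠ 0 → 0 < fundamentalTensor F y u u)
    (hy : y ≠ 0) (hs : s = β y / √(a y y))
    (hψ : 0 < c₁ + 2 * c₂ * s + c₃ * s ^ 2) (hT : 0 < c₁ + c₂ * s) :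
    IsRandersGram (gramMatrix F e y) (Matrix.of fun i j => h (e i) (e j)) (fun i => l (e i))
      (fun i => m (e i)) (e.equivFun x) (e.equivFun z) (c₁ + c₂ * s)
      (c₁ + 2 * c₂ * s + c₃ * s ^ 2) (c₂ + c₃ * s) c₃ (B - s ^ 2)
      ((c₁ + c₂ * s) * (c₁ + 2 * c₂ * s + c₃ * s ^ 2) + (B - s ^ 2) * (c₁ * c₃ - c₂ ^ 2)) := by
  have hdec := fun u v => fundamentalTensor_randers_eq hsymm hpos hF hy hs u v H.l_eq H.m_eq
  have hw := randers_w_pos H hsymm hpos hF hg hy hs hψ hT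
  refine ⟨?_, ?_, ?_, ?_, ?_, ?_, ?_, ?_, ?_, hT, hψ, by ring, hw⟩
  -- Bilinearity is not evident from the iterated derivative; it is read off the decomposition
  -- `hdec`.
  · let g : LinearMap.BilinForm ℝ V := LinearMap.mk₂ ℝ (fundamentalTensor F y)
      (by intros; simp only [hdec, map_add, LinearMap.add_apply]; ring)
      (by intros; simp only [hdec, map_smul, LinearMap.smul_apply, smul_eq_mul]; ring)
      (by intros; simp only [hdec, map_add]; ring)
      (by intros; simp only [hdec, map_smul, smul_eq_mul]; ring)
    exact isUnit_det_of_posDef (b := g) e (hg y hy)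
  · ext i j
    simp only [transpose_apply, of_apply, H.h_eq, hsymm (e j) (e i)]
    ring
  · ext i j
    simp only [gramMatrix, of_apply, hdec, ← H.h_eq, Matrix.add_apply, Matrix.smul_apply,
      vecMulVec_apply, smul_eq_mul]
  · rw [of_mulVec_equivFun]
    exact funext fun i => H.h_x _
  · rw [of_mulVec_equivFun]
    exact funext fun i => H.h_z _
  · rw [dotProduct_equivFun, H.l_x]
  · rw [dotProduct_equivFun, H.m_x]
  · rw [dotProduct_equivFun, H.l_z]
  · rw [dotProduct_equivFun, H.m_z]

section Norms

variable {G h : Matrix ι ι ℝ} {l m x z : ι → ℝ} {T ψ k c μ w κ : ℝ} {e}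

theorem IsRandersGram.meanCartanNorm_eq (H : IsRandersGram (gramMatrix F e y) h l m x z T ψ k c μ w)
    (hC : ∀ i j k, cartanTorsion F y (e i) (e j) (e k) = κ * symProd h m i j k) :
    meanCartanNorm F e y
      = √(κ ^ 2 * (((Fintype.card ι : ℝ) - 2) / T + 3 * (ψ / w)) ^ 2 * (ψ / w * μ)) := by
  have hI : ∀ i, meanCartanTorsion F e y (e i)
      = κ * (((Fintype.card ι : ℝ) - 2) / T + 3 * (ψ / w)) * m i := by
    intro i
    have h1 := sum_symProd_trace H.inv_symm h m i
    rw [H.trace_h_inv, H.h_inv_mulVec_m, Pi.smul_apply, smul_eq_mul] at h1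
    have h2 : meanCartanTorsion F e y (e i)
        = κ * ∑ j, ∑ k, (gramMatrix F e y)⁻¹ j k * symProd h m i j k := by
      simp only [meanCartanTorsion, hC, Finset.mul_sum]
      exact Finset.sum_congr rfl fun j _ => Finset.sum_congr rfl fun k _ => by ring
    rw [h2, h1]
    ring
  rw [meanCartanNorm, mul_assoc, ← H.m_inv_m]
  congr 1
  simp only [hI, dotProduct, mulVec, Finset.mul_sum]
  exact Finset.sum_congr rfl fun j _ => Finset.sum_congr rfl fun k _ => by ring

theorem IsRandersGram.cartanNorm_eq (H : IsRandersGram (gramMatrix F e y) h l m x z T ψ k c μ w)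
    (hC : ∀ i j k, cartanTorsion F y (e i) (e j) (e k) = κ * symProd h m i j k) :
    cartanNorm F e y
      = √(κ ^ 2 * (3 * (((Fintype.card ι : ℝ) - 2) / T ^ 2 + 3 * (ψ / w) ^ 2) * (ψ / w * μ))) := by
  have h1 := sum_symProd_normSq H.inv_symm H.h_symm H.h_inv_mulVec_m
  rw [H.trace_h_inv_sq, H.m_inv_m] at h1
  rw [cartanNorm]
  congr 1
  trans κ ^ 2 * ∑ i, ∑ j, ∑ k, ∑ l, ∑ r, ∑ t, (gramMatrix F e y)⁻¹ i l * (gramMatrix F e y)⁻¹ j r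
    * (gramMatrix F e y)⁻¹ k t * symProd h m i j k * symProd h m l r t
  · simp only [hC, Finset.mul_sum]
    refine Finset.sum_congr rfl fun _ _ => Finset.sum_congr rfl fun _ _ =>
      Finset.sum_congr rfl fun _ _ => Finset.sum_congr rfl fun _ _ =>
      Finset.sum_congr rfl fun _ _ => Finset.sum_congr rfl fun _ _ => by ring
  · rw [h1]
    ring

end Norms

/-- The pointwise identity between the norms of the Cartan torsion and its mean. -/
theorem cartanNorm_randers {n : ℕ} (hn : 2 ≤ n) (e : Module.Basis (Fin n) ℝ V)
    (H : IsAngularFrame a β y s B h l m x z)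
    (hsymm : ∀ u v, a u v = a v u) (hpos : ∀ z, z ≠ 0 → 0 < a z z)
    (hF : ∀ z, F z ^ 2 = randersSq c₁ c₂ c₃ a β z)
    (hg : ∀ y, y ≠ 0 → ∀ u, u ≠ 0 → 0 < fundamentalTensor F y u u)
    (hy : y ≠ 0) (hs : s = β y / √(a y y))
    (hψ : 0 < c₁ + 2 * c₂ * s + c₃ * s ^ 2) (hT : 0 < c₁ + c₂ * s) {p : ℝ}
    (hp : p = randersP n c₁ c₂ c₃ B s) :
    cartanNorm F e y = √((3 * p ^ 2 + 6 * p * (1 - p) + ((n : ℝ) + 1) * (1 - p) ^ 2)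
      / ((n : ℝ) + 1)) * meanCartanNorm F e y := by
  have hw := randers_w_pos H hsymm hpos hF hg hy hs hψ hT
  have hG := isRandersGram_gramMatrix e H hsymm hpos hF hg hy hs hψ hT
  have hC : ∀ i j k, cartanTorsion F y (e i) (e j) (e k) = c₂ / (2 * √(a y y))
      * symProd (Matrix.of fun i j => h (e i) (e j)) (fun i => m (e i)) i j k := by
    intro i j k
    rw [cartanTorsion_randers hsymm hpos hF hy _ _ _ H.l_eq (fun u => hs ▸ H.m_eq u) H.h_eq]
    rfl
  rw [hG.meanCartanNorm_eq hC, hG.cartanNorm_eq hC]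
  have hμ := H.nonneg hpos
  rw [← Real.sqrt_mul' _ (by positivity), Fintype.card_fin]
  congr 1
  rw [randersP, randersBigA_eq hψ hT hw] at hp
  set T := c₁ + c₂ * s
  set ψ := c₁ + 2 * c₂ * s + c₃ * s ^ 2
  set w := T * ψ + (B - s ^ 2) * (c₁ * c₃ - c₂ ^ 2)
  have hρ : 0 < ψ / w := div_pos hψ hw
  generalize ψ / w = ρ at hp hρ ⊢
  -- For `c₂ = 0` the Cartan torsion vanishes, so both sides are zero.
  by_cases hc : c₂ = 0
  · simp [hc]
  · have hn' : (0 : ℝ) ≤ (n : ℝ) - 2 := by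
      rw [sub_nonneg]
      exact_mod_cast hn
    have hX : 0 < (n : ℝ) - 2 + 3 * ρ * T := by positivity
    have hp' : p = ((n : ℝ) + 1) / ((n : ℝ) - 2 + 3 * ρ * T) := by
      rw [hp]
      field_simp
    have hn1 : (0 : ℝ) < (n : ℝ) + 1 := by positivity
    rw [hp']
    generalize c₂ / (2 * √(a y y)) = κ
    field_simp
    ring

end Pointwise

end FinslerGeometry

/-! ### Application to the tangent spaces of `M`. -/

open FinslerGeometry

theorem mainTheorem6 {n : ℕ} (hn : 2 ≤ n) {M : Type*} [TopologicalSpace M]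
    [ChartedSpace (EuclideanSpace ℝ (Fin n)) M] [IsManifold (𝓡 n) ∞ M]
    (c₁ c₂ c₃ : ℝ) (a : SmoothRiemannianMetric n M) (β : SmoothOneForm n M)
    (hF : IsFinslerMetric (generalizedRanders c₁ c₂ c₃ a β))
    (x : M) (y : TangentSpace (𝓡 n) x) (hy : y ≠ 0)
    (e : Module.Basis (Fin n) ℝ (TangentSpace (𝓡 n) x))
    (F : TangentSpace (𝓡 n) x → ℝ)
    (hFx : F = restrictFiber (generalizedRanders c₁ c₂ c₃ a β) x)
    (s B A p q : ℝ)
    (hs : s = β x y / alphaNorm a x y)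
    (hB : B = covectorNormSq (fun u v => a.inner x u v) (fun u => β x u) e)
    (hA : A = randersBigA n c₁ c₂ c₃ B s)
    (hp : p = randersP n c₁ c₂ c₃ B s)
    (hq : q = 1 - p) :
    F y = alphaNorm a x y * randersPhi c₁ c₂ c₃ s ∧
    0 < c₁ + 2 * c₂ * s + c₃ * s ^ 2 ∧
    0 < c₁ + c₂ * s ∧
    0 < (c₁ + c₂ * s) * (c₁ + 2 * c₂ * s + c₃ * s ^ 2)
      + (B - s ^ 2) * (c₁ * c₃ - c₂ ^ 2) ∧
    abFunA (randersPhi c₁ c₂ c₃) s = c₁ + c₂ * s ∧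
    abBigA n (randersPhi c₁ c₂ c₃) B s = A ∧
    (c₂ ≠ 0 → A ≠ 0) ∧
    abP n (randersPhi c₁ c₂ c₃) B s = p ∧
    cartanNorm F e y =
      Real.sqrt ((3 * p ^ 2 + 6 * p * q + ((n : ℝ) + 1) * q ^ 2) / ((n : ℝ) + 1))
        * meanCartanNorm F e y := by
  let a' : LinearMap.BilinForm ℝ (TangentSpace (𝓡 n) x) :=
    LinearMap.mk₂ ℝ (fun u v => a.inner x u v) (by intros; simp) (by intros; simp)
      (by intros; simp) (by intros; simp)
  let β' : TangentSpace (𝓡 n) x →ₗ[ℝ] ℝ := (β x).toLinearMap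
  have hsymm : ∀ u v, a' u v = a' v u := fun u v => a.symm x u v
  have hpos : ∀ z, z ≠ 0 → 0 < a' z z := fun z hz => a.pos x z hz
  have hnonneg : ∀ z, 0 ≤ F z := fun z => hFx ▸ hF.nonneg _
  have hhom : ∀ v, ∀ r : ℝ, 0 < r → F (r • v) = r * F v := fun v r hr =>
    hFx ▸ hF.homogeneous x v r hr
  have hg : ∀ y, y ≠ 0 → ∀ u, u ≠ 0 → 0 < fundamentalTensor F y u u := fun y hy u hu =>
    hFx ▸ hF.posDef x y hy u hu
  have hsqrt : ∀ z, F z = √(randersSq c₁ c₂ c₃ a' β' z) := by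
    intro z
    have h0 : 0 ≤ a' z z := by
      by_cases hz : z = 0
      · simp [hz]
      · exact (hpos z hz).le
    rw [hFx, randersSq, ← Real.sq_sqrt h0, Real.sqrt_sq (Real.sqrt_nonneg _)]
    rfl
  have hFpos : ∀ z, z ≠ 0 → 0 < F z := fun z hz =>
    pos_of_posDef_fundamentalTensor hnonneg hhom (hg z hz z hz)
  have hFsq : ∀ z, F z ^ 2 = randersSq c₁ c₂ c₃ a' β' z := by
    intro z
    by_cases hz : z = 0
    · rw [hsqrt]
      simp [hz, randersSq]
    -- `Real.sqrt` is zero on negative reals, so `F z > 0` is what makes the radicand positive.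
    · rw [hsqrt, Real.sq_sqrt (Real.sqrt_pos.1 (hsqrt z ▸ hFpos z hz)).le]
  have hs' : s = β' y / √(a' y y) := hs
  obtain ⟨b, hb, hBb⟩ := exists_dual_vector e hpos β'
  have hB' : B = β' b := hB.trans hBb
  obtain ⟨h, l, m, ξ, z, H⟩ := exists_isAngularFrame hsymm hb (hpos y hy) hs'
  rw [← hB'] at H
  have hα := Real.sqrt_pos.2 (hpos y hy)
  have hψ : 0 < c₁ + 2 * c₂ * s + c₃ * s ^ 2 := by
    have h1 := pow_pos (hFpos y hy) 2
    rw [hFsq, randersSq_eq hpos hy hs'] at h1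
    exact pos_of_mul_pos_right h1 (sq_nonneg _)
  have hT : 0 < c₁ + c₂ * s :=
    randers_T_pos hsymm hpos hFsq hFpos hg
      (exists_ne_zero_apply_eq_zero e (by rwa [Fintype.card_fin])) hb hy hs'
      (by rw [← hB']; linarith [H.nonneg hpos])
  have hw := randers_w_pos H hsymm hpos hFsq hg hy hs' hψ hT
  refine ⟨?_, hψ, hT, hw, abFunA_randersPhi hψ, hA ▸ abBigA_randersPhi hψ hw, fun hc => ?_,
    hp ▸ abP_randersPhi hψ hw, hq ▸ cartanNorm_randers hn e H hsymm hpos hFsq hg hy hs' hψ hT hp⟩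
  · rw [hsqrt, randersSq_eq hpos hy hs', Real.sqrt_mul (sq_nonneg _), Real.sqrt_sq hα.le]
    rfl
  · have hn' : (0 : ℝ) ≤ (n : ℝ) - 2 := by
      rw [sub_nonneg]
      exact_mod_cast hn
    rw [hA, randersBigA_eq hψ hT hw]
    exact neg_ne_zero.2 (mul_ne_zero hc (by positivity))
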